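/- Let $G=(V,E,W)$ be a finite connected simple graph with positive edge weights $W:E\to(0,\infty)$; the weight of a path is the sum of the weights of its edges. Fix a total order on $V$ and a field of coefficients. For $v,w\in V$ put $d_i(v,w)=0$ if $v=w$, and for $v\neq w$: - $d_1(v,w)$ is the weight of a chosen path $p_{vw}$ that has the minimum number of edges among all paths from $v$ to $w$ (for example the one that the unweighted Dijkstra algorithm selects by means of an ordering of the vertices; the choice is arbitrary, and $p_{wv}$ need not be the reverse of $p_{vw}$); - $d_2(v,w)$ is the minimum of the weights of all paths from $v$ to $w$; - $d_3(v,w)$ is the minimum of the weights of those paths from $v$ to $w$ that have the minimum number of edges. For $i=1,2,3$ let $f_i(\sigma)=\max_{v,w\in\sigma}d_i(v,w)$ be the Vietoris–Rips filtration value of a simplex $\emptyset\ne\sigma\subseteq V$. List all simplices as $\sigma_1,\dots,\sigma_m$ by increasing $f_i$, where simplices of equal value are ordered by a total order of the simplices that is the same for $i=1,2,3$ and in which every simplex comes after its proper faces. Let $R$ be the matrix obtained from the boundary matrix of this list by the standard column reduction from left to right, and for a nonzero column $k$ let $low_R(k)$ be the index of its lowest nonzero entry. The set $\mathcal B_i$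 of birth edges of the one-dimensional barcode $\mathsf{bcd}_1(d_i)$ consists of the $1$-simplices $\sigma_j$ whose column in $R$ is zero and such that either $low_R(k)=j$ for some $k$ with $f_i(\sigma_j)<f_i(\sigma_k)$ (the bar $[f_i(\sigma_j),f_i(\sigma_k)]$), or $low_R(k)=j$ for no $k$ (the bar $[f_i(\sigma_j),\infty]$). Then, for every such choice of the paths $p_{vw}$ and of the tie-breaking order, $$\mathcal B_2\subseteq\mathcal B_3\subseteq\mathcal B_1 .$$ -/

import Mathlib

section Graph

variable {V : Type*} {G : SimpleGraph V}

/-- The total weight of a path: the sum of the weights of its edges. Only the values of `W` on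
edges of `G` matter. -/
def pathWeight (W : Sym2 V → ℝ) {v w : V} (p : G.Path v w) : ℝ :=
  (p.1.edges.map W).sum

/-- `p` has the minimum number of edges among all paths between its endpoints. -/
def IsMinEdgePath {v w : V} (p : G.Path v w) : Prop :=
  ∀ q : G.Path v w, p.1.length ≤ q.1.length

/-- The first distance, with respect to a choice of one path `p v w` for each pair of vertices
(used for paths with the minimum number of edges, as selected by the unweighted Dijkstra algorithm
with some ordering of the vertices). -/
noncomputable def dist₁ [DecidableEq V] (W : Sym2 V → ℝ) (p : ∀ v w : V, G.Path v w)
    (v w : V) : ℝ :=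
  if v = w then 0 else pathWeight W (p v w)

/-- The second distance: the weight of a path of minimal total weight. -/
noncomputable def dist₂ [DecidableEq V] (G : SimpleGraph V) (W : Sym2 V → ℝ) (v w : V) : ℝ :=
  if v = w then 0 else ⨅ q : G.Path v w, pathWeight W q

/-- The third distance: the least weight of a path among the paths with the minimum number
of edges. -/
noncomputable def dist₃ [DecidableEq V] (G : SimpleGraph V) (W : Sym2 V → ℝ) (v w : V) : ℝ :=
  if v = w then 0 else ⨅ q : {q : G.Path v w // IsMinEdgePath q}, pathWeight W q.1

end Graph

section Filtration

variable {V : Type*}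

/-- The Vietoris-Rips filtration value of a simplex: the largest distance between two of its
vertices (both orders of the two vertices count, so that `d` need not be symmetric). -/
noncomputable def ripsValue (d : V → V → ℝ) (σ : Finset V) : ℝ :=
  if h : σ.Nonempty then (σ ×ˢ σ).sup' (h.product h) (fun q => d q.1 q.2) else 0

/-- A rule for ordering simplices of equal filtration value: a total order of the simplices
(given by a numbering) in which every simplex comes after its proper faces. For instance: first by
dimension, then lexicographically. -/
structure TieBreak (V : Type*) where
  rank : Finset V → ℕ
  injective : Function.Injective rank
  strictMono : StrictMono rank

/-- The simplices of the full Vietoris-Rips complex on `V`, to be listed in the order in which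
they enter the filtration of `d`, with ties resolved by `t`. -/
def RipsSimplex (_d : V → V → ℝ) (_t : TieBreak V) : Type _ :=
  {σ : Finset V // σ.Nonempty}

/-- The filtration order: first by filtration value, then by the tie-breaking rule. -/
noncomputable instance (d : V → V → ℝ) (t : TieBreak V) : LinearOrder (RipsSimplex d t) :=
  LinearOrder.lift' (fun σ => toLex (ripsValue d σ.1, t.rank σ.1)) (fun _ _ h =>
    Subtype.ext (t.injective (Prod.ext_iff.mp (toLex.injective h)).2))

noncomputable instance [Fintype V] (d : V → V → ℝ) (t : TieBreak V) :
    Fintype (RipsSimplex d t) :=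
  Fintype.ofInjective (fun σ : RipsSimplex d t => σ.1) Subtype.val_injective

/-- The simplicial boundary matrix with coefficients in `F`, rows and columns indexed by the
simplices in filtration order: in the column of `σ = [x₀, …, xₙ]`, `x₀ < ⋯ < xₙ`, the entry at the
face of `σ` opposite to `xₖ` is `(-1) ^ k`, and all other entries are `0`. -/
noncomputable def boundaryMatrix (F : Type*) [Field F] [LinearOrder V] (d : V → V → ℝ)
    (t : TieBreak V) : Matrix (RipsSimplex d t) (RipsSimplex d t) F :=
  fun τ σ => ∑ x ∈ σ.1, if τ.1 = σ.1.erase x then (-1) ^ (σ.1.filter (· < x)).card else 0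

end Filtration

section Reduction

variable {ι F : Type*} [Fintype ι] [LinearOrder ι] [Field F]

open Classical in
/-- `low R j` is the largest row index of a nonzero entry in column `j` of `R`, and `⊥` if the
column is zero. -/
noncomputable def low (R : Matrix ι ι F) (j : ι) : WithBot ι :=
  (Finset.univ.filter (fun i => R i j ≠ 0)).max

open Classical in
/-- One step of the reduction of column `j`: if some column `k < j` has the same lowest nonzero
row `l` as column `j`, subtract the multiple of column `k` that clears the entry at `(l, j)`;
otherwise do nothing. -/
noncomputable def reduceStep (j : ι) (R : Matrix ι ι F) : Matrix ι ι F :=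
  if h : ∃ q : ι × ι, q.1 < j ∧ low R q.1 = q.2 ∧ low R j = q.2 then
    R.updateCol j (fun i => R i j - R h.choose.2 j / R h.choose.2 h.choose.1 * R i h.choose.1)
  else R

/-- Repeat the step until nothing changes any more. Each effective step strictly lowers
`low R j`, so that as many repetitions as there are rows suffice. -/
noncomputable def reduceColumn (j : ι) (R : Matrix ι ι F) : Matrix ι ι F :=
  (reduceStep j)^[Fintype.card ι] R

/-- The standard algorithm: reduce the columns one after the other, from left to right. -/
noncomputable def reducedMatrix (D : Matrix ι ι F) : Matrix ι ι F :=
  ((Finset.univ : Finset ι).sort (· ≤ ·)).foldl (fun R j => reduceColumn j R) D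

end Reduction

/-- The birth edges of the one-dimensional persistence barcode (coefficients in `F`) of the
Vietoris-Rips filtration of `d`: the 1-simplices `e` that create a homology class (the column
of `e` in the reduced boundary matrix `R` is zero) and give a bar, which is either
`[f e, f τ]` with `low R τ = e` and `f e < f τ`, or `[f e, ∞]` if no such column `τ` exists. -/
def birthEdges (F : Type*) [Field F] {V : Type*} [Fintype V] [LinearOrder V] (d : V → V → ℝ)
    (t : TieBreak V) : Set (Finset V) :=
  {e | ∃ σ : RipsSimplex d t, σ.1 = e ∧ e.card = 2 ∧
    low (reducedMatrix (boundaryMatrix F d t)) σ = ⊥ ∧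
    ((∃ τ : RipsSimplex d t, low (reducedMatrix (boundaryMatrix F d t)) τ = σ ∧
        ripsValue d σ.1 < ripsValue d τ.1) ∨
      ¬ ∃ τ : RipsSimplex d t, low (reducedMatrix (boundaryMatrix F d t)) τ = σ)}

/-! Whether an edge `e` is a birth edge does not depend on the details of the reduction
(`mem_birthEdges_iff`): its boundary must lie in the span of the boundaries of earlier simplices,
and `e` must not be the last simplex of any boundary of a chain of simplices of value at most that
of `e`.

The comparison `birthEdges_subset_of_eq_or_between` then rests on pairs `{v, w}` with a vertex `u`
such that `{v, u}` and `{u, w}` have strictly smaller value. Such a pair is killed at once by the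
triangle `{v, u, w}`, so it is no birth edge, and its boundary is the sum of those of two earlier
pairs, up to sign. Hence a birth edge for `d` has the same value for `d'`, its boundary is still
spanned by earlier ones, and since `d ≤ d'` no chain can kill it sooner for `d'`.

For path distances the dichotomy is elementary (`ripsValue_pair_eq_or_exists_between`): an optimal
path is either a single edge, where the distances agree, or its second vertex lies strictly between
the ends because weights are positive. -/

/-! ### Correctness of the column reduction. -/

section MatrixReduction

open Submodule

variable {ι F : Type*} [LinearOrder ι] [Field F]

/-- `R` arises from `D` by adding to each column multiples of earlier columns. -/
def UpperEquivalent (D R : Matrix ι ι F) : Prop :=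
  ∀ j, R.col j - D.col j ∈ span F (D.col '' Set.Iio j)

theorem UpperEquivalent.col_mem {D R : Matrix ι ι F} (h : UpperEquivalent D R) {j : ι} {S : Set ι}
    (hS : Set.Iic j ⊆ S) : R.col j ∈ span F (D.col '' S) := by
  rw [← sub_add_cancel (R.col j) (D.col j)]
  exact add_mem (span_mono (Set.image_mono (Set.Iio_subset_Iic_self.trans hS)) (h j))
    (subset_span ⟨j, hS le_rfl, rfl⟩)

variable [Fintype ι]

theorem low_eq_coe_iff (R : Matrix ι ι F) (j l : ι) :
    low R j = l ↔ R l j ≠ 0 ∧ ∀ i, l < i → R i j = 0 := by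
  classical
  constructor
  · intro h
    have hmem := Finset.mem_of_max h
    refine ⟨by simpa using hmem, fun i hi => ?_⟩
    by_contra hne
    exact absurd (Finset.le_max_of_eq (by simpa using hne) h) (not_le.mpr hi)
  · rintro ⟨hl, hi⟩
    refine le_antisymm (Finset.max_le fun i hi' => ?_) (Finset.le_max (by simpa using hl))
    refine WithBot.coe_le_coe.mpr (not_lt.mp fun hlt => ?_)
    simp [hi i hlt] at hi'

theorem low_eq_bot_iff (R : Matrix ι ι F) (j : ι) : low R j = ⊥ ↔ R.col j = 0 := by
  classical
  rw [low, Finset.max_eq_bot, Finset.filter_eq_empty_iff]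
  simp [funext_iff]

theorem low_congr {R R' : Matrix ι ι F} {j j' : ι} (h : R.col j = R'.col j') :
    low R j = low R' j' := by
  have h' : ∀ i, R i j = R' i j' := fun i => congrFun h i
  unfold low
  congr 1
  ext i
  simp [h' i]

/-- No earlier column has the same lowest nonzero row as column `j`. -/
def ColumnReduced (R : Matrix ι ι F) (j : ι) : Prop :=
  ∀ k < j, ∀ l : ι, low R k = l → low R j ≠ l

theorem columnReduced_congr {R R' : Matrix ι ι F} {j : ι}
    (h : ∀ k ≤ j, R.col k = R'.col k) : ColumnReduced R j ↔ ColumnReduced R' j := by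
  unfold ColumnReduced
  rw [low_congr (h j le_rfl)]
  exact forall₂_congr fun k hk => by rw [low_congr (h k hk.le)]

theorem reduceStep_eq_self {R : Matrix ι ι F} {j : ι} (h : ColumnReduced R j) :
    reduceStep j R = R := by
  rw [reduceStep, dif_neg]
  rintro ⟨q, hq, h1, h2⟩
  exact h q.1 hq q.2 h1 h2

/-- Both columns vanish below row `l`, and the chosen multiple cancels the entry in row `l` itself.
-/
theorem reduceStep_spec {R : Matrix ι ι F} {j : ι} (h : ¬ ColumnReduced R j) :
    ∃ k < j, ∃ (l : ι) (a : F), low R j = l ∧ (reduceStep j R).col j = R.col j - a • R.col k ∧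
      low (reduceStep j R) j < l := by
  have h' : ∃ q : ι × ι, q.1 < j ∧ low R q.1 = q.2 ∧ low R j = q.2 := by
    simp only [ColumnReduced, not_forall, not_not] at h
    obtain ⟨k, hk, l, h1, h2⟩ := h
    exact ⟨(k, l), hk, h1, h2⟩
  obtain ⟨hk, h1, h2⟩ := h'.choose_spec
  have hcol : (reduceStep j R).col j =
      R.col j - (R h'.choose.2 j / R h'.choose.2 h'.choose.1) • R.col h'.choose.1 := by
    ext i
    rw [reduceStep, dif_pos h']
    simp
  refine ⟨h'.choose.1, hk, h'.choose.2, _, h2, hcol, ?_⟩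
  rw [low_eq_coe_iff] at h1 h2
  by_contra hlow
  obtain ⟨l, hl⟩ : ∃ l : ι, low (reduceStep j R) j = l := by
    cases hb : low (reduceStep j R) j with
    | bot => simp [hb] at hlow
    | coe l => exact ⟨l, rfl⟩
  rw [hl, WithBot.coe_lt_coe, not_lt] at hlow
  refine ((low_eq_coe_iff _ _ _).mp hl).1 ?_
  have hval := congrFun hcol l
  simp only [Matrix.col_apply, Pi.sub_apply, Pi.smul_apply, smul_eq_mul] at hval
  rw [hval]
  rcases hlow.eq_or_lt with rfl | hlt
  · rw [div_mul_cancel₀ _ h1.1, sub_self]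
  · rw [h1.2 l hlt, h2.2 l hlt]; simp

theorem reduceStep_col_of_ne {R : Matrix ι ι F} {j k : ι} (h : k ≠ j) :
    (reduceStep j R).col k = R.col k := by
  rw [reduceStep]
  split_ifs with hq
  · ext i; simp [Matrix.updateCol_ne h]
  · rfl

theorem reduceColumn_col_of_ne {R : Matrix ι ι F} {j k : ι} (h : k ≠ j) :
    (reduceColumn j R).col k = R.col k := by
  rw [reduceColumn]
  generalize Fintype.card ι = n
  induction n with
  | zero => rfl
  | succ n ih => rw [Function.iterate_succ_apply', reduceStep_col_of_ne h, ih]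

-- Termination count: the set of rows up to the current lowest entry loses at least one element with
-- each effective step.
open Classical in
theorem reduceStep_iterate_reduced (j : ι) (R : Matrix ι ι F) (n : ℕ) :
    ColumnReduced ((reduceStep j)^[n] R) j ∨
      (Finset.univ.filter fun i : ι => (i : WithBot ι) ≤ low ((reduceStep j)^[n] R) j).card + n
        ≤ Fintype.card ι := by
  induction n with
  | zero => exact Or.inr (Finset.card_le_univ _)
  | succ n ih =>
    rw [Function.iterate_succ_apply']
    by_cases hred : ColumnReduced ((reduceStep j)^[n] R) j
    · rw [reduceStep_eq_self hred]
      exact Or.inl hred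
    · obtain ⟨k, -, l, a, hl, -, hlt⟩ := reduceStep_spec hred
      have hcard := ih.resolve_left hred
      right
      have : (Finset.univ.filter fun i : ι =>
          (i : WithBot ι) ≤ low (reduceStep j ((reduceStep j)^[n] R)) j).card <
          (Finset.univ.filter fun i : ι =>
            (i : WithBot ι) ≤ low ((reduceStep j)^[n] R) j).card := by
        refine Finset.card_lt_card (Finset.ssubset_iff_of_subset ?_ |>.mpr ⟨l, ?_, ?_⟩)
        · intro i
          simp only [Finset.mem_filter, Finset.mem_univ, true_and, hl]
          exact fun h => h.trans hlt.le
        · simp [hl]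
        · simpa using hlt
      omega

theorem columnReduced_reduceColumn (j : ι) (R : Matrix ι ι F) :
    ColumnReduced (reduceColumn j R) j := by
  classical
  rcases reduceStep_iterate_reduced j R (Fintype.card ι) with h | h
  · exact h
  · intro k _ l _ hl
    rw [reduceColumn] at hl
    have hpos : 0 < (Finset.univ.filter fun i : ι =>
        (i : WithBot ι) ≤ low ((reduceStep j)^[Fintype.card ι] R) j).card :=
      Finset.card_pos.mpr ⟨l, by simp [hl]⟩
    omega

/-- The invariant of the left-to-right sweep: `S` holds the finished columns. They stay reduced
because only columns to their right are changed afterwards. -/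
theorem foldl_columnReduced (L : List ι) (hL : L.Pairwise (· < ·)) (S : Set ι)
    (R : Matrix ι ι F) (hS : ∀ j ∈ S, ∀ x ∈ L, j < x) (hR : ∀ j ∈ S, ColumnReduced R j) :
    ∀ j, j ∈ S ∨ j ∈ L → ColumnReduced (L.foldl (fun R j => reduceColumn j R) R) j := by
  induction L generalizing S R with
  | nil => simpa using hR
  | cons x L ih =>
    rw [List.pairwise_cons] at hL
    intro j hj
    refine ih hL.2 (insert x S) (reduceColumn x R) ?_ ?_ j ?_
    · rintro j (rfl | hj) y hy
      · exact hL.1 y hy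
      · exact hS j hj y (List.mem_cons_of_mem _ hy)
    · rintro j (rfl | hj)
      · exact columnReduced_reduceColumn j R
      · have hjx := hS j hj x List.mem_cons_self
        exact (columnReduced_congr fun k hk =>
          reduceColumn_col_of_ne (hk.trans_lt hjx).ne).mpr (hR j hj)
    · simp only [Set.mem_insert_iff, List.mem_cons] at hj ⊢
      tauto

theorem columnReduced_reducedMatrix (D : Matrix ι ι F) (j : ι) :
    ColumnReduced (reducedMatrix D) j :=
  foldl_columnReduced _ (Finset.sortedLT_sort _).pairwise ∅ D (by simp) (by simp) j (by simp)

theorem UpperEquivalent.reduceStep {D R : Matrix ι ι F} (h : UpperEquivalent D R) (j : ι) :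
    UpperEquivalent D (reduceStep j R) := by
  intro i
  by_cases hred : ColumnReduced R j
  · rw [reduceStep_eq_self hred]; exact h i
  rcases eq_or_ne i j with rfl | hij
  · obtain ⟨k, hk, l, a, -, hcol, -⟩ := reduceStep_spec hred
    rw [hcol, sub_right_comm]
    exact sub_mem (h i) (smul_mem _ _ (h.col_mem fun x hx => lt_of_le_of_lt hx hk))
  · rw [reduceStep_col_of_ne hij]; exact h i

theorem UpperEquivalent.reduceColumn {D R : Matrix ι ι F} (h : UpperEquivalent D R) (j : ι) :
    UpperEquivalent D (reduceColumn j R) := by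
  rw [_root_.reduceColumn]
  generalize Fintype.card ι = n
  induction n with
  | zero => exact h
  | succ n ih => rw [Function.iterate_succ_apply']; exact ih.reduceStep j

theorem upperEquivalent_reducedMatrix (D : Matrix ι ι F) : UpperEquivalent D (reducedMatrix D) := by
  rw [reducedMatrix]
  generalize (Finset.univ : Finset ι).sort (· ≤ ·) = L
  suffices ∀ R, UpperEquivalent D R →
      UpperEquivalent D (L.foldl (fun R j => _root_.reduceColumn j R) R) from
    this D fun j => by simp
  induction L with
  | nil => exact fun R h => h
  | cons x L ih => exact fun R h => ih _ (h.reduceColumn x)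

/-- The change of columns is unitriangular, hence invertible within every initial segment. -/
theorem UpperEquivalent.span_eq {D R : Matrix ι ι F} (h : UpperEquivalent D R) {S : Set ι}
    (hS : IsLowerSet S) : span F (R.col '' S) = span F (D.col '' S) := by
  apply le_antisymm <;> rw [span_le]
  · rintro _ ⟨j, hj, rfl⟩
    exact h.col_mem fun x hx => hS hx hj
  · rintro _ ⟨j, hj, rfl⟩
    induction j using WellFoundedLT.induction with
    | ind j ih =>
      rw [← sub_sub_cancel (R.col j) (D.col j)]
      refine sub_mem (subset_span ⟨j, hj, rfl⟩) (?_ : _ ∈ span F _)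
      refine (span_le.mpr ?_ : span F (D.col '' Set.Iio j) ≤ _) (h j)
      rintro _ ⟨k, hk, rfl⟩
      exact ih k hk (hS (le_of_lt hk) hj)

/-- The leading entry of a nonzero combination of reduced columns is the lowest entry of one of
these columns. -/
theorem exists_low_of_mem_span {R : Matrix ι ι F} (hR : ∀ j, ColumnReduced R j) {S : Set ι}
    {v : ι → F} (hv : v ∈ span F (R.col '' S)) (hv0 : v ≠ 0) :
    ∃ k ∈ S, ∃ l : ι, low R k = l ∧ v l ≠ 0 ∧ ∀ i, l < i → v i = 0 := by
  classical
  rw [Finsupp.mem_span_image_iff_linearCombination] at hv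
  obtain ⟨y, hy, rfl⟩ := hv
  have hval : ∀ i, Finsupp.linearCombination F R.col y i = ∑ k ∈ y.support, y k * R i k := by
    intro i
    simp [Finsupp.linearCombination_apply, Finsupp.sum, Finset.sum_apply]
  have hne : (y.support.filter fun k => R.col k ≠ 0).Nonempty := by
    by_contra hempty
    rw [Finset.not_nonempty_iff_eq_empty, Finset.filter_eq_empty_iff] at hempty
    refine hv0 (funext fun i => (hval i).trans (Finset.sum_eq_zero fun k hk => ?_))
    have := congrFun (not_not.mp (hempty hk)) i
    rw [Matrix.col_apply] at this
    simp [this]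
  -- Lowest rows of distinct nonzero columns differ, so the entry of the column with the largest
  -- `low` cannot cancel.
  obtain ⟨k, hk, hmax⟩ := Finset.exists_max_image _ (low R) hne
  rw [Finset.mem_filter] at hk
  obtain ⟨l, hl⟩ : ∃ l : ι, low R k = l := by
    cases hb : low R k with
    | bot => exact absurd ((low_eq_bot_iff _ _).mp hb) hk.2
    | coe l => exact ⟨l, rfl⟩
  have hl' := (low_eq_coe_iff _ _ _).mp hl
  have hle : ∀ k' ∈ y.support, ∀ i, l ≤ i → R i k' ≠ 0 → low R k' = l ∧ i = l := by
    intro k' hk' i hi hik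
    have h1 : low R k' ≤ l := hl ▸ hmax k' (Finset.mem_filter.mpr
      ⟨hk', fun h0 => hik (congrFun h0 i)⟩)
    have h2 : (i : WithBot ι) ≤ low R k' := Finset.le_max (by simpa using hik)
    have hil : i = l := le_antisymm (WithBot.coe_le_coe.mp (h2.trans h1)) hi
    exact ⟨le_antisymm h1 (hil ▸ h2), hil⟩
  refine ⟨k, hy hk.1, l, hl, ?_, fun i hi => ?_⟩
  · rw [hval, Finset.sum_eq_single_of_mem k hk.1]
    · exact mul_ne_zero (Finsupp.mem_support_iff.mp hk.1) hl'.1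
    · intro k' hk' hkk
      by_contra h0
      have := (hle k' hk' l le_rfl (right_ne_zero_of_mul h0)).1
      rcases lt_or_gt_of_ne hkk with hlt | hlt
      · exact hR k k' hlt l this hl
      · exact hR k' k hlt l hl this
  · rw [hval]
    refine Finset.sum_eq_zero fun k' hk' => ?_
    by_contra h0
    exact hi.ne' (hle k' hk' i hi.le (right_ne_zero_of_mul h0)).2

theorem low_reducedMatrix_eq_bot_iff (D : Matrix ι ι F) (j : ι) :
    low (reducedMatrix D) j = ⊥ ↔ D.col j ∈ span F (D.col '' Set.Iio j) := by
  have hU := upperEquivalent_reducedMatrix D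
  rw [low_eq_bot_iff]
  constructor
  · intro h0
    simpa [h0] using hU j
  · intro hj
    by_contra h0
    have hmem : (reducedMatrix D).col j ∈ span F ((reducedMatrix D).col '' Set.Iio j) := by
      rw [hU.span_eq (isLowerSet_Iio j), ← sub_add_cancel ((reducedMatrix D).col j) (D.col j)]
      exact add_mem (hU j) hj
    obtain ⟨k, hk, l, hl, hvl, hvi⟩ :=
      exists_low_of_mem_span (columnReduced_reducedMatrix D) hmem h0
    exact columnReduced_reducedMatrix D j k hk l hl ((low_eq_coe_iff _ _ _).mpr ⟨hvl, hvi⟩)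

/-- Pairing read off from `D` alone; taking a sublevel set for `S` also tells when the pairing
happens. -/
theorem exists_low_reducedMatrix_iff (D : Matrix ι ι F) (l : ι) {S : Set ι} (hS : IsLowerSet S) :
    (∃ k ∈ S, low (reducedMatrix D) k = l) ↔
      ∃ v ∈ span F (D.col '' S), v l ≠ 0 ∧ ∀ i, l < i → v i = 0 := by
  have hU := upperEquivalent_reducedMatrix D
  constructor
  · rintro ⟨k, hk, hl⟩
    exact ⟨_, hU.col_mem fun x hx => hS hx hk, (low_eq_coe_iff _ _ _).mp hl⟩
  · rintro ⟨v, hv, hvl, hvi⟩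
    rw [← hU.span_eq hS] at hv
    obtain ⟨k, hk, l', hl', hvl', hvi'⟩ := exists_low_of_mem_span
      (columnReduced_reducedMatrix D) hv (fun h0 => hvl (congrFun h0 l))
    refine ⟨k, hk, ?_⟩
    rcases lt_trichotomy l l' with h | rfl | h
    · exact absurd (hvi l' h) hvl'
    · exact hl'
    · exact absurd (hvi' l h) hvl

end MatrixReduction

/-! ### Filtration values. -/

section RipsValue

variable {V : Type*}

theorem ripsValue_le_iff (d : V → V → ℝ) {σ : Finset V} (h : σ.Nonempty) (r : ℝ) :
    ripsValue d σ ≤ r ↔ ∀ x ∈ σ, ∀ y ∈ σ, d x y ≤ r := by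
  rw [ripsValue, dif_pos h, Finset.sup'_le_iff]
  simp only [Finset.mem_product, Prod.forall, and_imp]
  exact ⟨fun h x hx y hy => h x y hx hy, fun h x y hx hy => h x hx y hy⟩

theorem le_ripsValue (d : V → V → ℝ) {σ : Finset V} {x y : V} (hx : x ∈ σ) (hy : y ∈ σ) :
    d x y ≤ ripsValue d σ :=
  (ripsValue_le_iff d ⟨x, hx⟩ _).mp le_rfl x hx y hy

theorem ripsValue_mono {d d' : V → V → ℝ} (h : ∀ x y, d x y ≤ d' x y) (σ : Finset V) :
    ripsValue d σ ≤ ripsValue d' σ := by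
  by_cases hσ : σ.Nonempty
  · rw [ripsValue_le_iff d hσ]
    exact fun x hx y hy => (h x y).trans (le_ripsValue d' hx hy)
  · simp [ripsValue, hσ]

end RipsValue

/-! ### Birth edges in terms of spans of boundaries. -/

section BirthEdges

open Submodule

variable {V : Type*} (F : Type*) [Field F]

/-- The boundary of a simplex, as a function on all simplices. -/
noncomputable def simplexBoundary [LinearOrder V] (σ : Finset V) :
    {τ : Finset V // τ.Nonempty} → F :=
  fun τ => ∑ x ∈ σ, if τ.1 = σ.erase x then (-1) ^ (σ.filter (· < x)).card else 0

/-- The order in which simplices enter the Vietoris-Rips filtration of `d`. -/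
def FiltrationLT (d : V → V → ℝ) (t : TieBreak V) (σ τ : Finset V) : Prop :=
  ripsValue d σ < ripsValue d τ ∨ ripsValue d σ = ripsValue d τ ∧ t.rank σ < t.rank τ

theorem RipsSimplex.lt_iff {d : V → V → ℝ} {t : TieBreak V} {σ τ : RipsSimplex d t} :
    σ < τ ↔ FiltrationLT d t σ.1 τ.1 :=
  Prod.Lex.toLex_lt_toLex

theorem FiltrationLT.le {d : V → V → ℝ} {t : TieBreak V} {σ τ : Finset V}
    (h : FiltrationLT d t σ τ) : ripsValue d σ ≤ ripsValue d τ :=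
  h.elim (fun h => h.le) (fun h => h.1.le)

/-- Finite and infinite bars merge into one condition: no column of value at most that of `e` has
its lowest entry at `e`. The simplices are indexed independently of `d`, so that two filtrations can
be compared. -/
theorem mem_birthEdges_iff [Fintype V] [LinearOrder V] (d : V → V → ℝ) (t : TieBreak V)
    {e : Finset V} (he : e.Nonempty) :
    e ∈ birthEdges F d t ↔ e.card = 2 ∧
      simplexBoundary F e ∈
        span F (simplexBoundary F '' {τ | τ.Nonempty ∧ FiltrationLT d t τ e}) ∧
      ¬ ∃ v ∈ span F (simplexBoundary F '' {τ | τ.Nonempty ∧ ripsValue d τ ≤ ripsValue d e}),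
        v ⟨e, he⟩ ≠ 0 ∧ ∀ τ, FiltrationLT d t e τ.1 → v τ = 0 := by
  set D := boundaryMatrix F d t with hD
  let σ : RipsSimplex d t := ⟨e, he⟩
  have hcol : ∀ τ : RipsSimplex d t, D.col τ = simplexBoundary F τ.1 := fun _ => rfl
  have hpos : low (reducedMatrix D) σ = ⊥ ↔ simplexBoundary F e ∈
      span F (simplexBoundary F '' {τ | τ.Nonempty ∧ FiltrationLT d t τ e}) := by
    rw [low_reducedMatrix_eq_bot_iff]
    have : D.col '' Set.Iio σ =
        simplexBoundary F '' {τ | τ.Nonempty ∧ FiltrationLT d t τ e} := by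
      ext v
      constructor
      · rintro ⟨τ, hτ, rfl⟩
        exact ⟨τ.1, ⟨τ.2, RipsSimplex.lt_iff.mp hτ⟩, rfl⟩
      · rintro ⟨τ, ⟨hτ, hlt⟩, rfl⟩
        exact ⟨⟨τ, hτ⟩, RipsSimplex.lt_iff.mpr hlt, rfl⟩
    rw [this]
    exact Iff.rfl
  let S : Set (RipsSimplex d t) := {τ | ripsValue d τ.1 ≤ ripsValue d e}
  have hS : IsLowerSet S := by
    intro τ τ' hle hτ
    rcases hle.eq_or_lt with rfl | hlt
    · exact hτ
    · exact (RipsSimplex.lt_iff.mp hlt).le.trans hτ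
  have hdeath : (∃ τ ∈ S, low (reducedMatrix D) τ = σ) ↔
      ∃ v ∈ span F (simplexBoundary F '' {τ | τ.Nonempty ∧ ripsValue d τ ≤ ripsValue d e}),
        v ⟨e, he⟩ ≠ 0 ∧ ∀ τ, FiltrationLT d t e τ.1 → v τ = 0 := by
    rw [exists_low_reducedMatrix_iff D σ hS]
    have : D.col '' S =
        simplexBoundary F '' {τ | τ.Nonempty ∧ ripsValue d τ ≤ ripsValue d e} := by
      ext v
      constructor
      · rintro ⟨τ, hτ, rfl⟩
        exact ⟨τ.1, ⟨τ.2, hτ⟩, rfl⟩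
      · rintro ⟨τ, ⟨hτ, hle⟩, rfl⟩
        exact ⟨⟨τ, hτ⟩, hle, rfl⟩
    rw [this]
    refine exists_congr fun v => and_congr Iff.rfl (and_congr Iff.rfl ?_)
    exact forall_congr' fun τ => imp_congr_left RipsSimplex.lt_iff
  rw [← hpos, ← hdeath]
  constructor
  · rintro ⟨σ', hσ', hcard, hbot, hbar⟩
    obtain rfl : σ' = σ := Subtype.ext hσ'
    refine ⟨hcard, hbot, ?_⟩
    rintro ⟨τ, hτ, hlow⟩
    rcases hbar with ⟨τ', hlow', hlt⟩ | hbar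
    · have hne : τ ≠ τ' := by
        rintro rfl
        exact absurd hlt (not_lt.mpr hτ)
      rcases lt_or_gt_of_ne hne with h | h
      · exact columnReduced_reducedMatrix D τ' τ h σ hlow hlow'
      · exact columnReduced_reducedMatrix D τ τ' h σ hlow' hlow
    · exact hbar ⟨τ, hlow⟩
  · rintro ⟨hcard, hbot, hdeath⟩
    refine ⟨σ, rfl, hcard, hbot, ?_⟩
    by_cases hex : ∃ τ : RipsSimplex d t, low (reducedMatrix D) τ = σ
    · obtain ⟨τ, hτ⟩ := hex
      exact Or.inl ⟨τ, hτ, not_le.mp fun hle => hdeath ⟨τ, hle, hτ⟩⟩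
    · exact Or.inr hex

/-! ### Boundaries of edges and comparison of two filtrations. -/

variable [LinearOrder V]

theorem simplexBoundary_apply_of_card_ne {σ : Finset V} {τ : {τ : Finset V // τ.Nonempty}}
    (h : τ.1.card + 1 ≠ σ.card) : simplexBoundary F σ τ = 0 := by
  refine Finset.sum_eq_zero fun x hx => if_neg fun hτ => h ?_
  rw [hτ, Finset.card_erase_add_one hx]

theorem simplexBoundary_apply_eq_zero {σ : Finset V} {τ : {τ : Finset V // τ.Nonempty}}
    (h : ∀ x ∈ σ, τ.1 ≠ σ.erase x) : simplexBoundary F σ τ = 0 :=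
  Finset.sum_eq_zero fun x hx => if_neg (h x hx)

theorem simplexBoundary_apply_erase_ne_zero {σ : Finset V} {x : V} (hx : x ∈ σ)
    (hσ : (σ.erase x).Nonempty) : simplexBoundary F σ ⟨σ.erase x, hσ⟩ ≠ 0 := by
  rw [simplexBoundary, Finset.sum_eq_single_of_mem x hx]
  · simp
  · intro y hy hyx
    refine if_neg fun h => ?_
    exact Finset.notMem_erase y σ (h ▸ Finset.mem_erase.mpr ⟨hyx, hy⟩)

/-- The chain consisting of a single vertex. -/
def vertexChain (v : V) : {τ : Finset V // τ.Nonempty} → F :=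
  fun τ => if τ.1 = {v} then 1 else 0

theorem simplexBoundary_pair {v w : V} (h : v < w) :
    simplexBoundary F {v, w} = vertexChain F w - vertexChain F v := by
  ext τ
  have h1 : ({v, w} : Finset V).erase v = {w} := by
    rw [Finset.erase_insert (by simpa using h.ne)]
  have h2 : ({v, w} : Finset V).erase w = {v} := by
    rw [Finset.pair_comm, Finset.erase_insert (by simpa using h.ne')]
  have h3 : ({v, w} : Finset V).filter (· < v) = ∅ := by
    ext x; simp only [Finset.mem_filter, Finset.mem_insert, Finset.mem_singleton,
      Finset.notMem_empty, iff_false]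
    rintro ⟨rfl | rfl, hx⟩
    · exact lt_irrefl _ hx
    · exact lt_asymm h hx
  have h4 : ({v, w} : Finset V).filter (· < w) = {v} := by
    ext x; simp only [Finset.mem_filter, Finset.mem_insert, Finset.mem_singleton]
    constructor
    · rintro ⟨rfl | rfl, hx⟩
      · rfl
      · exact absurd hx (lt_irrefl _)
    · rintro rfl
      exact ⟨Or.inl rfl, h⟩
  rw [simplexBoundary, Finset.sum_pair h.ne, h1, h2, h3, h4]
  simp only [vertexChain, Pi.sub_apply, Finset.card_empty, Finset.card_singleton]
  split_ifs <;> simp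

theorem simplexBoundary_pair_mem_iff {v w : V} (h : v ≠ w)
    (M : Submodule F ({τ : Finset V // τ.Nonempty} → F)) :
    simplexBoundary F {v, w} ∈ M ↔ vertexChain F w - vertexChain F v ∈ M := by
  rcases lt_or_gt_of_ne h with h | h
  · rw [simplexBoundary_pair F h]
  · rw [Finset.pair_comm, simplexBoundary_pair F h, ← neg_mem_iff, neg_sub]

/-- Only edges contribute to the boundary of an edge. -/
theorem simplexBoundary_mem_span_edges {e : Finset V} (he : e.card = 2) {S : Set (Finset V)}
    (h : simplexBoundary F e ∈ span F (simplexBoundary F '' S)) :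
    simplexBoundary F e ∈ span F (simplexBoundary F '' {σ ∈ S | σ.card = 2}) := by
  -- Projection to the vertex coordinates: it fixes boundaries of edges and annihilates all others.
  let P : ({τ : Finset V // τ.Nonempty} → F) →ₗ[F] ({τ : Finset V // τ.Nonempty} → F) :=
    LinearMap.pi fun τ => if τ.1.card = 1 then LinearMap.proj τ else 0
  have hP : ∀ σ : Finset V, σ.card = 2 → P (simplexBoundary F σ) = simplexBoundary F σ := by
    intro σ hσ
    ext τ
    by_cases hτ : τ.1.card = 1
    · simp [P, hτ]
    · rw [simplexBoundary_apply_of_card_ne F (by omega)]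
      simp [P, hτ]
  have hP' : ∀ σ : Finset V, σ.card ≠ 2 → P (simplexBoundary F σ) = 0 := by
    intro σ hσ
    ext τ
    by_cases hτ : τ.1.card = 1
    · simp [P, hτ, simplexBoundary_apply_of_card_ne F (σ := σ) (τ := τ) (by omega)]
    · simp [P, hτ]
  have hmem := mem_map_of_mem (f := P) h
  rw [hP e he, map_span] at hmem
  refine span_le.mpr ?_ hmem
  rintro _ ⟨_, ⟨σ, hσ, rfl⟩, rfl⟩
  by_cases hcard : σ.card = 2
  · rw [hP σ hcard]
    exact subset_span ⟨σ, ⟨hσ, hcard⟩, rfl⟩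
  · rw [hP' σ hcard]
    exact zero_mem _

theorem ripsValue_triangle_le (d : V → V → ℝ) {u v w : V}
    (h1 : ripsValue d {v, u} ≤ ripsValue d {v, w}) (h2 : ripsValue d {u, w} ≤ ripsValue d {v, w}) :
    ripsValue d {v, u, w} ≤ ripsValue d {v, w} := by
  rw [ripsValue_le_iff d ⟨u, by simp⟩] at h1 h2 ⊢
  have h3 := (ripsValue_le_iff d ⟨v, by simp⟩ _).mp (le_refl (ripsValue d {v, w}))
  simp only [Finset.mem_insert, Finset.mem_singleton, forall_eq_or_imp, forall_eq] at h1 h2 h3 ⊢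
  tauto

variable {F} in
/-- A pair with a vertex strictly between its ends is killed at once by a triangle. -/
theorem pair_notMem_birthEdges_of_between [Fintype V] {d : V → V → ℝ} {t : TieBreak V} {u v w : V}
    (hvw : v ≠ w) (huv : u ≠ v) (huw : u ≠ w)
    (h1 : ripsValue d {v, u} < ripsValue d {v, w}) (h2 : ripsValue d {u, w} < ripsValue d {v, w}) :
    {v, w} ∉ birthEdges F d t := by
  have hne : ({v, w} : Finset V).Nonempty := ⟨v, by simp⟩
  rw [mem_birthEdges_iff F d t hne]
  rintro ⟨-, -, h⟩
  -- The triangle has the value of `{v, w}`, and strictness makes `{v, w}` its last face whatever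
  -- the tie-breaking.
  refine h ⟨simplexBoundary F {v, u, w}, subset_span ⟨{v, u, w}, ⟨⟨v, by simp⟩,
    ripsValue_triangle_le d h1.le h2.le⟩, rfl⟩, ?_, ?_⟩
  · have he : ({v, u, w} : Finset V).erase u = {v, w} := by
      ext x; simp only [Finset.mem_erase, Finset.mem_insert, Finset.mem_singleton]; grind
    have := simplexBoundary_apply_erase_ne_zero F (σ := {v, u, w}) (x := u) (by simp)
      (he ▸ hne)
    simpa only [he] using this
  · intro τ hτ
    refine simplexBoundary_apply_eq_zero F fun x hx hτx => ?_
    have hlt : ¬ ripsValue d τ.1 < ripsValue d {v, w} := not_lt.mpr hτ.le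
    simp only [Finset.mem_insert, Finset.mem_singleton] at hx
    rcases hx with rfl | rfl | rfl
    · have : τ.1 = {u, w} := by
        rw [hτx]; ext y; simp only [Finset.mem_erase, Finset.mem_insert, Finset.mem_singleton]
        grind
      exact hlt (this ▸ h2)
    · have : τ.1 = {v, w} := by
        rw [hτx]; ext y; simp only [Finset.mem_erase, Finset.mem_insert, Finset.mem_singleton]
        grind
      rw [this] at hτ
      exact hτ.elim (lt_irrefl _) (fun h => lt_irrefl _ h.2)
    · have : τ.1 = {v, u} := by
        rw [hτx]; ext y; simp only [Finset.mem_erase, Finset.mem_insert, Finset.mem_singleton]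
        grind
      exact hlt (this ▸ h1)

/-- If `d ≤ d'` and the two filtrations agree on every pair without a vertex strictly between its
ends, then the birth edges of `d` are birth edges of `d'`. -/
theorem birthEdges_subset_of_eq_or_between [Fintype V] {d d' : V → V → ℝ} (t : TieBreak V)
    (hle : ∀ v w, d v w ≤ d' v w)
    (h : ∀ v w, v ≠ w → ripsValue d {v, w} = ripsValue d' {v, w} ∨
      ∃ u, u ≠ v ∧ u ≠ w ∧ ripsValue d {v, u} < ripsValue d {v, w} ∧
        ripsValue d {u, w} < ripsValue d {v, w}) :
    birthEdges F d t ⊆ birthEdges F d' t := by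
  intro e he
  have hcard : e.card = 2 := he.choose_spec.2.1
  have hne : e.Nonempty := Finset.card_pos.mp (by omega)
  have heq : ripsValue d e = ripsValue d' e := by
    obtain ⟨v, w, hvw, rfl⟩ := Finset.card_eq_two.mp hcard
    refine (h v w hvw).resolve_right ?_
    rintro ⟨u, huv, huw, h1, h2⟩
    exact pair_notMem_birthEdges_of_between hvw huv huw h1 h2 he
  have hmono := ripsValue_mono hle
  rw [mem_birthEdges_iff F _ t hne] at he ⊢
  obtain ⟨-, hcycle, hdeath⟩ := he
  refine ⟨hcard, ?_, ?_⟩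
  · set M := span F (simplexBoundary F '' {τ | τ.Nonempty ∧ FiltrationLT d' t τ e}) with hM
    have hwf : WellFounded fun σ τ : Finset V => ripsValue d σ < ripsValue d τ :=
      Finite.wellFounded_of_trans_of_irrefl _
    -- Induction on the `d`-value: a pair with a vertex `u` between is replaced by two pairs of
    -- smaller value, and the differences of end vertices telescope.
    have hpair : ∀ σ v w, v ≠ w → σ = {v, w} → FiltrationLT d t σ e →
        vertexChain F w - vertexChain F v ∈ M := by
      intro σ
      induction σ using hwf.induction with
      | h σ ih =>
        rintro v w hvw rfl hlt
        rcases h v w hvw with hval | ⟨u, huv, huw, h1, h2⟩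
        · rw [← simplexBoundary_pair_mem_iff F hvw]
          refine hM ▸ subset_span (Set.mem_image_of_mem _ ⟨⟨v, by simp⟩, ?_⟩)
          rwa [FiltrationLT, ← hval, ← heq]
        · rw [← sub_add_sub_cancel (vertexChain F w) (vertexChain F u)]
          exact add_mem (ih _ h2 u w huw rfl (Or.inl (h2.trans_le hlt.le)))
            (ih _ h1 v u huv.symm rfl (Or.inl (h1.trans_le hlt.le)))
    refine span_le.mpr ?_ (simplexBoundary_mem_span_edges F hcard hcycle)
    rintro _ ⟨σ, ⟨⟨-, hσ⟩, hσ2⟩, rfl⟩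
    obtain ⟨v, w, hvw, rfl⟩ := Finset.card_eq_two.mp hσ2
    exact (simplexBoundary_pair_mem_iff F hvw M).mpr (hpair _ v w hvw rfl hσ)
  · rintro ⟨v, hv, hve, hv0⟩
    -- A chain killing `e` at its birth for `d'` would also do so for `d`: values only grow from `d`
    -- to `d'` while that of `e` is fixed, so simplices after `e` for `d` are after `e` for `d'`.
    have hsub : {τ : Finset V | τ.Nonempty ∧ ripsValue d' τ ≤ ripsValue d' e} ⊆
        {τ | τ.Nonempty ∧ ripsValue d τ ≤ ripsValue d e} :=
      fun τ hτ => ⟨hτ.1, (hmono τ).trans (hτ.2.trans heq.ge)⟩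
    refine hdeath ⟨v, span_mono (Set.image_mono hsub) hv, hve, fun τ hτ => hv0 τ ?_⟩
    rcases hτ with hlt | ⟨hval, hrank⟩
    · exact Or.inl (heq ▸ hlt.trans_le (hmono τ.1))
    · rcases (hmono τ.1).eq_or_lt with h' | h'
      · exact Or.inr ⟨by rw [← heq, hval, h'], hrank⟩
      · exact Or.inl (by rw [← heq, hval]; exact h')

end BirthEdges

/-! ### Optimal paths and intermediate vertices. -/

section PathDistances

variable {V : Type*} {G : SimpleGraph V}

theorem pathWeight_cons (W : Sym2 V → ℝ) {u v w : V} (h : G.Adj u v) (q : G.Walk v w)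
    (hq : (q.cons h).IsPath) (hq' : q.IsPath) :
    pathWeight W (⟨q.cons h, hq⟩ : G.Path u w) = W s(u, v) + pathWeight W ⟨q, hq'⟩ := by
  simp [pathWeight]

theorem pathWeight_reverse (W : Sym2 V → ℝ) {v w : V} (q : G.Path v w) :
    pathWeight W q.reverse = pathWeight W q := by
  simp [pathWeight, SimpleGraph.Path.reverse, List.sum_reverse]

theorem pathWeight_singleton (W : Sym2 V → ℝ) {v w : V} (h : G.Adj v w) :
    pathWeight W (SimpleGraph.Path.singleton h) = W s(v, w) := by
  simp [pathWeight, SimpleGraph.Path.singleton]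

theorem pathWeight_nonneg {W : Sym2 V → ℝ} (hW : ∀ e ∈ G.edgeSet, 0 < W e) {v w : V}
    (q : G.Path v w) : 0 ≤ pathWeight W q := by
  refine List.sum_nonneg fun x hx => ?_
  obtain ⟨e, he, rfl⟩ := List.mem_map.mp hx
  exact (hW e (q.1.edges_subset_edgeSet he)).le

theorem pathWeight_pos {W : Sym2 V → ℝ} (hW : ∀ e ∈ G.edgeSet, 0 < W e) {v w : V}
    (hvw : v ≠ w) (q : G.Path v w) : 0 < pathWeight W q := by
  obtain ⟨q, hq⟩ := q
  cases q with
  | nil => exact absurd rfl hvw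
  | cons h q =>
    have hq' := (SimpleGraph.Walk.cons_isPath_iff _ _).mp hq |>.1
    rw [pathWeight_cons W h q hq hq']
    exact add_pos_of_pos_of_nonneg (hW s(_, _) h) (pathWeight_nonneg hW _)

theorem isMinEdgePath_singleton {v w : V} (h : G.Adj v w) :
    IsMinEdgePath (SimpleGraph.Path.singleton h) := by
  intro q
  have : q.1.length ≠ 0 := fun h0 => h.ne (SimpleGraph.Walk.eq_of_length_eq_zero h0)
  simp only [SimpleGraph.Path.singleton, SimpleGraph.Walk.length_cons,
    SimpleGraph.Walk.length_nil]
  omega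

theorem IsMinEdgePath.reverse {v w : V} {q : G.Path v w} (h : IsMinEdgePath q) :
    IsMinEdgePath q.reverse := by
  intro q'
  simpa [SimpleGraph.Path.reverse] using h q'.reverse

/-- A shorter path from `v` would, after prepending the edge and removing possible cycles, beat the
original path. -/
theorem IsMinEdgePath.tail {u v w : V} {h : G.Adj u v} {q : G.Walk v w}
    {hq : (q.cons h).IsPath} (hq' : q.IsPath)
    (hmin : IsMinEdgePath (⟨q.cons h, hq⟩ : G.Path u w)) :
    IsMinEdgePath (⟨q, hq'⟩ : G.Path v w) := by
  classical
  intro r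
  have h1 := hmin (r.1.cons h).toPath
  have h2 : (r.1.cons h).toPath.1.length ≤ (r.1.cons h).length :=
    SimpleGraph.Walk.length_bypass_le_length _
  simp only [SimpleGraph.Walk.length_cons] at h1 h2 ⊢
  omega

theorem IsMinEdgePath.eq_singleton {v w : V} {q : G.Path v w} (hq : IsMinEdgePath q)
    (h : G.Adj v w) : q = SimpleGraph.Path.singleton h := by
  have hlen := hq (SimpleGraph.Path.singleton h)
  obtain ⟨q, hpath⟩ := q
  cases q with
  | nil => exact absurd rfl h.ne
  | cons h' q =>
    cases q with
    | nil => rfl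
    | cons h'' q => simp [SimpleGraph.Path.singleton] at hlen

/-- If `d` is the least weight of the paths in a class closed under reversal, passing to the tail
and taking edges, then the two ends of every pair of vertices are joined by an edge realizing their
distance, or there is a vertex between them. -/
theorem ripsValue_pair_eq_or_exists_between [DecidableEq V]
    {W : Sym2 V → ℝ} (hW : ∀ e ∈ G.edgeSet, 0 < W e)
    (Q : ∀ {v w : V}, Set (G.Path v w))
    (hrev : ∀ {v w : V} {q : G.Path v w}, q ∈ Q → q.reverse ∈ Q)
    (htail : ∀ {u v w : V} {h : G.Adj u v} {q : G.Walk v w} {hq : (q.cons h).IsPath}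
      (hq' : q.IsPath), (⟨q.cons h, hq⟩ : G.Path u w) ∈ Q → (⟨q, hq'⟩ : G.Path v w) ∈ Q)
    (hedge : ∀ {v w : V} (h : G.Adj v w), SimpleGraph.Path.singleton h ∈ Q)
    {d d' : V → V → ℝ}
    (hd : ∀ v w, IsLeast ((fun q : G.Path v w => pathWeight W q) '' Q) (d v w))
    (hself : ∀ v, d' v v = 0) (hle : ∀ v w, d v w ≤ d' v w)
    (hadj : ∀ v w, G.Adj v w → d' v w ≤ W s(v, w)) {v w : V} (hvw : v ≠ w) :
    ripsValue d {v, w} = ripsValue d' {v, w} ∨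
      ∃ u, u ≠ v ∧ u ≠ w ∧ ripsValue d {v, u} < ripsValue d {v, w} ∧
        ripsValue d {u, w} < ripsValue d {v, w} := by
  have hnonneg : ∀ x y, 0 ≤ d x y := fun x y => by
    obtain ⟨q, -, hq⟩ := (hd x y).1
    rw [← hq]
    exact pathWeight_nonneg hW q
  have hle_symm : ∀ x y, d x y ≤ d y x := fun x y => by
    obtain ⟨q, hq, hqd⟩ := (hd y x).1
    rw [← hqd]
    exact (hd x y).2 ⟨_, hrev hq, pathWeight_reverse W q⟩
  have hpair : ∀ x y, ripsValue d {x, y} ≤ d x y := fun x y => by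
    have hx : ∀ z, d z z ≤ d x y := fun z => (hle z z).trans ((hself z).le.trans (hnonneg x y))
    rw [ripsValue_le_iff d ⟨x, by simp⟩]
    simp [hx, hle_symm]
  have hvwd : d v w ≤ ripsValue d {v, w} := le_ripsValue d (by simp) (by simp)
  obtain ⟨⟨q, hpath⟩, hq, hqd⟩ := (hd v w).1
  dsimp only at hqd
  cases q with
  | nil => exact absurd rfl hvw
  | @cons _ u _ h q =>
    have hq' := (SimpleGraph.Walk.cons_isPath_iff _ _).mp hpath |>.1
    rw [pathWeight_cons W h q hpath hq'] at hqd
    rcases eq_or_ne u w with rfl | huw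
    · left
      have hnil : pathWeight W (⟨q, hq'⟩ : G.Path u u) = 0 := by
        rw [SimpleGraph.Path.loop_eq ⟨q, hq'⟩]
        simp [pathWeight]
      rw [hnil, add_zero] at hqd
      refine le_antisymm (ripsValue_mono hle _) (le_trans ?_ hvwd)
      have hz : ∀ z, d' z z ≤ d v u := fun z => (hself z).le.trans (hnonneg v u)
      have h1 : d' v u ≤ d v u := (hadj v u h).trans hqd.le
      -- `d'` need not be symmetric, so the reversed edge is bounded separately.
      have h2 : d' u v ≤ d v u := (hadj u v h.symm).trans (by rw [Sym2.eq_swap]; exact hqd.le)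
      rw [ripsValue_le_iff d' ⟨v, by simp⟩]
      simp [hz, h1, h2]
    · right
      -- The optimal path splits at `u` into its first edge and its tail, both admissible and of
      -- positive weight.
      have hvu : d v u ≤ W s(v, u) := (hd v u).2 ⟨_, hedge h, pathWeight_singleton W h⟩
      have huwd : d u w ≤ pathWeight W ⟨q, hq'⟩ := (hd u w).2 ⟨_, htail hq' hq, rfl⟩
      have hpos := pathWeight_pos hW huw ⟨q, hq'⟩
      have hpos' := hW s(v, u) h
      exact ⟨u, h.ne', huw, by linarith [hpair v u], by linarith [hpair u w]⟩

variable [Fintype V] [DecidableEq V]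

theorem isLeast_dist₂ (hG : G.Connected) (W : Sym2 V → ℝ) (v w : V) :
    IsLeast (Set.range fun q : G.Path v w => pathWeight W q) (dist₂ G W v w) := by
  classical
  rcases eq_or_ne v w with rfl | h
  · rw [dist₂, if_pos rfl]
    refine ⟨⟨SimpleGraph.Path.nil, by simp [pathWeight]⟩, ?_⟩
    rintro _ ⟨q, rfl⟩
    rw [q.loop_eq]
    simp [pathWeight]
  · have : Nonempty (G.Path v w) := ⟨(hG.preconnected v w).some.toPath⟩
    rw [dist₂, if_neg h]
    refine ⟨exists_eq_ciInf_of_finite, ?_⟩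
    rintro _ ⟨q, rfl⟩
    exact ciInf_le (Set.finite_range _).bddBelow q

theorem exists_isMinEdgePath (hG : G.Connected) (v w : V) :
    ∃ q : G.Path v w, IsMinEdgePath q := by
  classical
  have : Nonempty (G.Path v w) := ⟨(hG.preconnected v w).some.toPath⟩
  exact Finite.exists_min fun q : G.Path v w => q.1.length

theorem isLeast_dist₃ (hG : G.Connected) (W : Sym2 V → ℝ) (v w : V) :
    IsLeast ((fun q : G.Path v w => pathWeight W q) '' {q | IsMinEdgePath q})
      (dist₃ G W v w) := by
  classical
  rcases eq_or_ne v w with rfl | h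
  · rw [dist₃, if_pos rfl]
    refine ⟨⟨SimpleGraph.Path.nil, fun q => by simp, by simp [pathWeight]⟩, ?_⟩
    rintro _ ⟨q, -, rfl⟩
    dsimp only
    rw [q.loop_eq]
    simp [pathWeight]
  · have : Nonempty {q : G.Path v w // IsMinEdgePath q} :=
      let ⟨q, hq⟩ := exists_isMinEdgePath hG v w
      ⟨⟨q, hq⟩⟩
    rw [dist₃, if_neg h]
    constructor
    · obtain ⟨q, hq⟩ := exists_eq_ciInf_of_finite
        (f := fun q : {q : G.Path v w // IsMinEdgePath q} => pathWeight W q.1)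
      exact ⟨q.1, q.2, hq⟩
    · rintro _ ⟨q, hq, rfl⟩
      exact ciInf_le (Set.finite_range
        fun q : {q : G.Path v w // IsMinEdgePath q} => pathWeight W q.1).bddBelow ⟨q, hq⟩

end PathDistances

/-! ### The two inclusions. -/

theorem mainTheorem2 {V : Type*} [Fintype V] [LinearOrder V] (F : Type*) [Field F]
    (G : SimpleGraph V) (hG : G.Connected)
    (W : Sym2 V → ℝ) (hW : ∀ e ∈ G.edgeSet, 0 < W e)
    (p : ∀ v w : V, G.Path v w) (hp : ∀ v w : V, IsMinEdgePath (p v w))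
    (t : TieBreak V) :
    birthEdges F (dist₂ G W) t ⊆ birthEdges F (dist₃ G W) t ∧
      birthEdges F (dist₃ G W) t ⊆ birthEdges F (dist₁ W p) t := by
  have hle₂ : ∀ v w, dist₂ G W v w ≤ dist₃ G W v w := fun v w =>
    (isLeast_dist₃ hG W v w).mono (isLeast_dist₂ hG W v w) (Set.image_subset_range _ _)
  have hle₃ : ∀ v w, dist₃ G W v w ≤ dist₁ W p v w := by
    intro v w
    rcases eq_or_ne v w with rfl | h
    · simp [dist₃, dist₁]
    · rw [dist₁, if_neg h]
      exact (isLeast_dist₃ hG W v w).2 ⟨p v w, hp v w, rfl⟩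
  constructor
  · refine birthEdges_subset_of_eq_or_between F t hle₂ fun v w hvw =>
      ripsValue_pair_eq_or_exists_between hW (fun {_ _} => Set.univ) (fun _ => trivial)
        (fun _ _ => trivial) (fun _ => trivial) (fun v w => ?_) (fun v => by simp [dist₃]) hle₂
        (fun v w h => ?_) hvw
    · rw [Set.image_univ]
      exact isLeast_dist₂ hG W v w
    · exact (isLeast_dist₃ hG W v w).2
        ⟨_, isMinEdgePath_singleton h, pathWeight_singleton W h⟩
  · refine birthEdges_subset_of_eq_or_between F t hle₃ fun v w hvw =>
      ripsValue_pair_eq_or_exists_between hW (fun {_ _} => {q | IsMinEdgePath q})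
        (fun h => h.reverse) (fun hq' h => h.tail hq') isMinEdgePath_singleton
        (isLeast_dist₃ hG W) (fun v => by simp [dist₁]) hle₃ (fun v w h => ?_) hvw
    -- Between adjacent vertices the edge is the only path with fewest edges, so the arbitrary
    -- choice of `p` has no effect there.
    rw [dist₁, if_neg h.ne, (hp v w).eq_singleton h, pathWeight_singleton]
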